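/- Let $\lambda\in(0,1)$. For $s\in\mathbb{C}$ put $$F(\lambda,s)=\int_0^1\Bigl(\frac1u-1\Bigr)^{\lambda}\Bigl(1-\frac{\lambda}{1-u}\Bigr)e^{-us}\,du .$$ 1. For every real $s>0$ the integral $F(\lambda,s)$ converges absolutely and $F(\lambda,s)>0$. 2. Let $x>y>0$ and let $G_{x,y;\lambda}(z)=(x+z)^{\lambda}(y+z)^{1-\lambda}$ with principal branches of the powers. Then $G_{x,y;\lambda}$ is holomorphic on $\mathbb{C}\setminus(-\infty,-y]$, agrees with the real weighted geometric mean at real $z=t>-y$, and has the integral representation $$G_{x,y;\lambda}(z)=x^{\lambda}y^{1-\lambda}+z+\frac{\sin(\lambda\pi)}{\pi}(x-y)\int_0^{\infty}\frac{F(\lambda,(x-y)s)}{s}\,e^{-sy}\bigl(1-e^{-sz}\bigr)\,ds,\qquad z\in\mathbb{C}\setminus(-\infty,-y],$$ in the following sense. If $\operatorname{Re}z\ge-y$, the integral over the positive half-line converges absolutely and the identity holds. In general, for every $z\in\mathbb{C}\setminus(-\infty,-y]$ and every $\omega\in\mathbb{C}$ with $\operatorname{Re}\omega>0$ and $\operatorname{Re}(\omega(y+z))\ge0$,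 the integral taken from $0$ to $\infty$ along the ray $\{\omega r:r>0\}$ converges absolutely and the identity holds with it; for every such $z$ there is an $\omega$ with $\operatorname{Re}\omega>0$ and $\operatorname{Re}(\omega(y+z))>0$. 3. For all $x,y>0$ the function $G_{x,y;\lambda}(t)=(x+t)^{\lambda}(y+t)^{1-\lambda}$ is a Bernstein function of $t\in(-\min\{x,y\},\infty)$; that is, it is nonnegative and infinitely differentiable there, and $(-1)^k\,(G_{x,y;\lambda}')^{(k)}(t)\ge0$ for all integers $k\ge0$ and all $t>-\min\{x,y\}$. -/

import Mathlib

/-- Complete monotonicity on an (open) interval `I`: `f` has derivatives of all orders on `I`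
and `(-1)^k f^{(k)} ≥ 0` on `I` for all `k ≥ 0`. -/
def IsCompletelyMonotonicOn (f : ℝ → ℝ) (I : Set ℝ) : Prop :=
  ContDiffOn ℝ (⊤ : ℕ∞) f I ∧ ∀ k : ℕ, ∀ t ∈ I, 0 ≤ (-1 : ℝ) ^ k * iteratedDeriv k f t

/-- Bernstein function on an (open) interval `I`: nonnegative, with derivatives of all orders,
and with completely monotonic derivative. -/
def IsBernsteinOn (f : ℝ → ℝ) (I : Set ℝ) : Prop :=
  (∀ t ∈ I, 0 ≤ f t) ∧ ContDiffOn ℝ (⊤ : ℕ∞) f I ∧ IsCompletelyMonotonicOn (deriv f) I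

/-- The weighted geometric mean `(x+t)^l (y+t)^(1-l)` of a real variable `t`. -/
noncomputable def weightedGeom (x y l t : ℝ) : ℝ :=
  (x + t) ^ l * (y + t) ^ (1 - l)

/-- The principal branch of `(x+z)^l (y+z)^(1-l)`. -/
noncomputable def weightedGeomC (x y l : ℝ) (z : ℂ) : ℂ :=
  ((x : ℂ) + z) ^ (l : ℂ) * ((y : ℂ) + z) ^ ((1 - l : ℝ) : ℂ)

/-- The slit plane `ℂ ∖ (-∞, -y]`. -/
def slitAt (y : ℝ) : Set ℂ :=
  (Complex.ofReal '' Set.Iic (-y))ᶜ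

/-- The weight `(1/u - 1)^l (1 - l/(1-u))`, for `0 < u < 1`. -/
noncomputable def kernelWeight (l u : ℝ) : ℝ :=
  (1 / u - 1) ^ l * (1 - l / (1 - u))

/-- `F(l,s) = ∫_0^1 (1/u - 1)^l (1 - l/(1-u)) e^{-us} du` for real `s`. -/
noncomputable def kernelF (l s : ℝ) : ℝ :=
  ∫ u in Set.Ioo (0 : ℝ) 1, kernelWeight l u * Real.exp (-(u * s))

/-- The same integral `F(l,s)` for complex `s`. -/
noncomputable def kernelFC (l : ℝ) (s : ℂ) : ℂ :=
  ∫ u in Set.Ioo (0 : ℝ) 1, (kernelWeight l u : ℂ) * Complex.exp (-((u : ℂ) * s))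

/-- The integrand `F(l,(x-y)s)/s · e^{-sy} (1 - e^{-sz})` on the positive half-line. -/
noncomputable def meanIntegrand (x y l : ℝ) (z : ℂ) (s : ℝ) : ℂ :=
  ((kernelF l ((x - y) * s) / s * Real.exp (-(s * y)) : ℝ) : ℂ) *
    (1 - Complex.exp (-((s : ℂ) * z)))

/-- The integrand `F(l,(x-y)s)/s · e^{-sy} (1 - e^{-sz})` for complex `s`. -/
noncomputable def meanIntegrandC (x y l : ℝ) (z s : ℂ) : ℂ :=
  kernelFC l (((x - y : ℝ) : ℂ) * s) / s * Complex.exp (-(s * (y : ℂ))) *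
    (1 - Complex.exp (-(s * z)))

/-- The pull-back `r ↦ f(ωr) ω` of `f(s) ds` to the ray `{ωr : r > 0}`, so that
`∫_{ray} f(s) ds = ∫_0^∞ f(ωr) ω dr`. -/
def alongRay (f : ℂ → ℂ) (ω : ℂ) (r : ℝ) : ℂ :=
  f (ω * (r : ℂ)) * ω

/-!
The function `(x+z)^l (y+z)^(1-l)` is holomorphic off its cut, and its jump across the cut at `-a`,
`y < a < x`, is `2i sin(lπ) (a-y)^(1-l) (x-a)^l`. This suggests that, up to an affine function, it
is `-sin(lπ)/π` times the Stieltjes transform of the measure `μ` with density `(a-y)^(1-l) (x-a)^l`.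
For real `z = t` this is an explicit computation: after a partial fraction expansion of `1/(a+t)`,
a Möbius substitution turns every integral that appears into a Beta integral. The identity theorem
then extends the formula to the slit plane.

The Bernstein property follows because each `-1/(a+t)` has a completely monotonic derivative. For
the integral representation, write `1/(a+z)` as the Laplace integral of `e^{-s(a+z)}` along a ray
and apply Fubini's theorem; subtracting the values at `z` and `0` produces the factor `1 - e^{-sz}`.
The Laplace transform of `μ` is a rescaling of the one for `x = 1` and `y = 0`, whose density
`u^(1-l) (1-u)^l` is a primitive of the weight of `F` that vanishes at both endpoints. Integration
by parts therefore identifies `F(l,s)/s` with that Laplace transform, and shows that `F > 0`.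
-/

open MeasureTheory Set Filter Topology

section CompletelyMonotonic

variable {I : Set ℝ} {f g : ℝ → ℝ} {D : ℕ → ℝ → ℝ}

theorem iteratedDeriv_eqOn_of_hasDerivAt (hI : IsOpen I)
    (hD : ∀ k, ∀ t ∈ I, HasDerivAt (D k) (D (k + 1) t) t) (k : ℕ) :
    EqOn (iteratedDeriv k (D 0)) (D k) I := by
  induction k with
  | zero => exact fun t _ ↦ by rw [iteratedDeriv_zero]
  | succ k ih =>
    intro t ht
    rw [iteratedDeriv_succ, (ih.eventuallyEq_of_mem (hI.mem_nhds ht)).deriv_eq]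
    exact (hD k t ht).deriv

theorem contDiffOn_of_hasDerivAt (hI : IsOpen I)
    (hD : ∀ k, ∀ t ∈ I, HasDerivAt (D k) (D (k + 1) t) t) : ContDiffOn ℝ (⊤ : ℕ∞) (D 0) I := by
  refine contDiffOn_of_differentiableOn_deriv fun k _ ↦ ?_
  have hdiff : DifferentiableOn ℝ (D k) I := fun t ht ↦
    (hD k t ht).differentiableAt.differentiableWithinAt
  exact hdiff.congr <|
    (iteratedDerivWithin_of_isOpen hI).trans (iteratedDeriv_eqOn_of_hasDerivAt hI hD k)

theorem isCompletelyMonotonicOn_of_hasDerivAt (hI : IsOpen I)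
    (hD : ∀ k, ∀ t ∈ I, HasDerivAt (D k) (D (k + 1) t) t)
    (hsign : ∀ k, ∀ t ∈ I, 0 ≤ (-1) ^ k * D k t) : IsCompletelyMonotonicOn (D 0) I :=
  ⟨contDiffOn_of_hasDerivAt hI hD, fun k t ht ↦ by
    rw [iteratedDeriv_eqOn_of_hasDerivAt hI hD k ht]
    exact hsign k t ht⟩

namespace IsCompletelyMonotonicOn

theorem congr (hg : IsCompletelyMonotonicOn g I) (hI : IsOpen I) (h : EqOn f g I) :
    IsCompletelyMonotonicOn f I :=
  ⟨hg.1.congr h, fun k t ht ↦ by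
    rw [h.iteratedDeriv_of_isOpen hI k ht]
    exact hg.2 k t ht⟩

theorem const_mul (hf : IsCompletelyMonotonicOn f I) {c : ℝ} (hc : 0 ≤ c) :
    IsCompletelyMonotonicOn (fun t ↦ c * f t) I :=
  ⟨contDiffOn_const.mul hf.1, fun k t ht ↦ by
    rw [iteratedDeriv_const_mul_field, mul_left_comm]
    exact mul_nonneg hc (hf.2 k t ht)⟩

theorem const_add (hf : IsCompletelyMonotonicOn f I) {c : ℝ} (hc : 0 ≤ c) :
    IsCompletelyMonotonicOn (fun t ↦ c + f t) I := by
  refine ⟨contDiffOn_const.add hf.1, fun k t ht ↦ ?_⟩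
  have hk := hf.2 k t ht
  rcases k.eq_zero_or_pos with rfl | hpos
  · simp only [pow_zero, one_mul, iteratedDeriv_zero] at hk ⊢
    exact add_nonneg hc hk
  · rwa [iteratedDeriv_const_add hpos]

end IsCompletelyMonotonicOn

end CompletelyMonotonic

/-- The Stieltjes transform `∫ dμ(a) / (a + z)^n` of order `n` of a measure on the line. It is
defined over both scalar fields, so that it can be differentiated in a real and in a complex
variable; the derivative of order `k` is a multiple of the transform of order `n + k`. -/
noncomputable def stieltjesTransform {𝕜 : Type*} [RCLike 𝕜] (μ : Measure ℝ) (n : ℕ) (z : 𝕜) : 𝕜 :=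
  ∫ a, (((a : 𝕜) + z) ^ n)⁻¹ ∂μ

section StieltjesTransform

variable {𝕜 : Type*} [RCLike 𝕜] {μ : Measure ℝ}

theorem stieltjesTransform_ofReal (μ : Measure ℝ) (n : ℕ) (t : ℝ) :
    stieltjesTransform μ n (t : ℂ) = (stieltjesTransform μ n t : ℝ) := by
  simp only [stieltjesTransform]
  rw [← integral_complex_ofReal]
  push_cast
  rfl

theorem stieltjesTransform_nonneg (n : ℕ) {t : ℝ} (ht : ∀ᵐ a ∂μ, 0 ≤ a + t) :
    0 ≤ stieltjesTransform μ n t :=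
  integral_nonneg_of_ae <| ht.mono fun _ ha ↦ inv_nonneg.2 (pow_nonneg ha n)

theorem integrable_inv_add_pow [IsFiniteMeasure μ] (n : ℕ) {z : 𝕜} {δ : ℝ} (hδ : 0 < δ)
    (hz : ∀ᵐ a : ℝ ∂μ, δ ≤ ‖(a : 𝕜) + z‖) : Integrable (fun a : ℝ ↦ (((a : 𝕜) + z) ^ n)⁻¹) μ := by
  refine .of_bound (by fun_prop) (δ ^ n)⁻¹ (hz.mono fun a ha ↦ ?_)
  rw [norm_inv, norm_pow]
  gcongr

theorem hasDerivAt_stieltjesTransform [IsFiniteMeasure μ] (n : ℕ) {z : 𝕜} {δ : ℝ} (hδ : 0 < δ)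
    (hz : ∀ᵐ a : ℝ ∂μ, δ ≤ ‖(a : 𝕜) + z‖) :
    HasDerivAt (stieltjesTransform μ n) (-n * stieltjesTransform μ (n + 1) z) z := by
  have hball : ∀ᵐ a : ℝ ∂μ, ∀ w ∈ Metric.ball z (δ / 2), δ / 2 ≤ ‖(a : 𝕜) + w‖ := by
    filter_upwards [hz] with a ha w hw
    have htri := norm_sub_le ((a : 𝕜) + w) (w - z)
    rw [show (a : 𝕜) + w - (w - z) = a + z by ring] at htri
    linarith [mem_ball_iff_norm.1 hw]
  have hderiv := hasDerivAt_integral_of_dominated_loc_of_deriv_le (μ := μ)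
    (F := fun w (a : ℝ) ↦ (((a : 𝕜) + w) ^ n)⁻¹)
    (F' := fun w (a : ℝ) ↦ -n * (((a : 𝕜) + w) ^ (n + 1))⁻¹)
    (bound := fun _ ↦ n * ((δ / 2) ^ (n + 1))⁻¹) (Metric.ball_mem_nhds z (half_pos hδ))
    (.of_forall fun w ↦ by fun_prop) (integrable_inv_add_pow n hδ hz) (by fun_prop)
    (hball.mono fun a ha w hw ↦ ?bound) (integrable_const _) (hball.mono fun a ha w hw ↦ ?deriv)
  case bound =>
    rw [norm_mul, norm_neg, RCLike.norm_natCast, norm_inv, norm_pow]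
    gcongr
    exact ha w hw
  case deriv =>
    have hne : (a : 𝕜) + w ≠ 0 := norm_pos_iff.1 ((half_pos hδ).trans_le (ha w hw))
    refine ((((hasDerivAt_id w).const_add (a : 𝕜)).pow n).inv
      (pow_ne_zero n hne)).congr_deriv ?_
    cases n <;> simp [field, pow_succ]
  exact hderiv.2.congr_deriv (integral_const_mul _ _)

theorem isCompletelyMonotonicOn_stieltjesTransform [IsFiniteMeasure μ] {y : ℝ}
    (hμ : ∀ᵐ a ∂μ, y ≤ a) (n : ℕ) :
    IsCompletelyMonotonicOn (stieltjesTransform μ n) (Ioi (-y)) := by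
  let D (k : ℕ) (t : ℝ) : ℝ := (-1) ^ k * n.ascFactorial k * stieltjesTransform μ (n + k) t
  have hpos {t : ℝ} (ht : t ∈ Ioi (-y)) : 0 < y + t := neg_lt_iff_pos_add'.1 ht
  have hD (k : ℕ) (t : ℝ) (ht : t ∈ Ioi (-y)) : HasDerivAt (D k) (D (k + 1) t) t := by
    have hδ : ∀ᵐ a ∂μ, y + t ≤ ‖a + t‖ :=
      hμ.mono fun a ha ↦ (add_le_add_left ha t).trans (le_abs_self _)
    refine ((hasDerivAt_stieltjesTransform (n + k) (hpos ht) hδ).const_mul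
      ((-1) ^ k * (n.ascFactorial k : ℝ))).congr_deriv ?_
    simp only [D, Nat.ascFactorial_succ, ← add_assoc, pow_succ]
    push_cast
    ring
  have hsign (k : ℕ) (t : ℝ) (ht : t ∈ Ioi (-y)) : 0 ≤ (-1) ^ k * D k t := by
    have hS : 0 ≤ stieltjesTransform μ (n + k) t :=
      stieltjesTransform_nonneg _ (hμ.mono fun a ha ↦ by linarith [hpos ht])
    rw [← mul_assoc, ← mul_assoc, ← mul_pow, neg_one_mul, neg_neg, one_pow, one_mul]
    positivity
  exact (isCompletelyMonotonicOn_of_hasDerivAt isOpen_Ioi hD hsign).congr isOpen_Ioi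
    fun t _ ↦ by simp [D]

theorem isBernsteinOn_of_eqOn_sub_stieltjesTransform [IsFiniteMeasure μ] {y : ℝ}
    (hμ : ∀ᵐ a ∂μ, y ≤ a) {f : ℝ → ℝ} {A c : ℝ} (hc : 0 ≤ c) (hf : ∀ t ∈ Ioi (-y), 0 ≤ f t)
    (h : EqOn f (fun t ↦ A + t - c * stieltjesTransform μ 1 t) (Ioi (-y))) :
    IsBernsteinOn f (Ioi (-y)) := by
  have hS := (isCompletelyMonotonicOn_stieltjesTransform hμ 1).1
  have hsmooth : ContDiffOn ℝ (⊤ : ℕ∞) f (Ioi (-y)) :=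
    ((contDiffOn_const.add contDiffOn_id).sub (contDiffOn_const.mul hS)).congr h
  have hderiv : EqOn (deriv f) (fun t ↦ 1 + c * stieltjesTransform μ 2 t) (Ioi (-y)) := by
    intro t ht
    have hpos : 0 < y + t := neg_lt_iff_pos_add'.1 ht
    have hS' := hasDerivAt_stieltjesTransform (z := t) 1 hpos
      (hμ.mono fun a ha ↦ (add_le_add_left ha t).trans (le_abs_self (a + t)))
    rw [(h.eventuallyEq_of_mem (isOpen_Ioi.mem_nhds ht)).deriv_eq]
    exact ((((hasDerivAt_id t).const_add A).sub (hS'.const_mul c)).congr_deriv (by simp)).deriv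
  exact ⟨hf, hsmooth, (((isCompletelyMonotonicOn_stieltjesTransform hμ 2).const_mul
    hc).const_add zero_le_one).congr isOpen_Ioi hderiv⟩

end StieltjesTransform

section SlitPlane

variable {y : ℝ} {z : ℂ}

theorem mem_slitAt_iff : z ∈ slitAt y ↔ (y : ℂ) + z ∈ Complex.slitPlane := by
  rw [← not_iff_not, Complex.mem_slitPlane_iff, slitAt, mem_compl_iff, not_not]
  constructor
  · rintro ⟨t, ht, rfl⟩
    simpa using le_neg_iff_add_nonpos_left.1 (mem_Iic.1 ht)
  · intro h
    simp only [Complex.add_re, Complex.ofReal_re, Complex.add_im, Complex.ofReal_im, zero_add,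
      not_or, not_lt, not_not] at h
    exact ⟨z.re, le_neg_iff_add_nonpos_left.2 h.1, Complex.ext rfl h.2.symm⟩

theorem ofReal_mem_slitAt {t : ℝ} (ht : -y < t) : (t : ℂ) ∈ slitAt y := by
  rintro ⟨s, hs, hst⟩
  exact ht.not_ge (Complex.ofReal_injective hst ▸ hs)

theorem monotone_slitAt : Monotone slitAt := fun _ _ h ↦
  compl_subset_compl.2 <| image_mono <| Iic_subset_Iic.2 <| neg_le_neg h

theorem isOpen_slitAt (y : ℝ) : IsOpen (slitAt y) :=
  (Complex.isometry_ofReal.isClosedEmbedding.isClosedMap _ isClosed_Iic).isOpen_compl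

theorem isPreconnected_slitAt (y : ℝ) : IsPreconnected (slitAt y) := by
  have hpre : slitAt y = Homeomorph.addLeft (y : ℂ) ⁻¹' Complex.slitPlane :=
    ext fun _ ↦ mem_slitAt_iff
  rw [hpre, Homeomorph.isPreconnected_preimage]
  exact (Complex.starConvex_one_slitPlane.isPathConnected
    Complex.one_mem_slitPlane).isConnected.isPreconnected

theorem exists_le_norm_add_of_mem_slitAt (hz : z ∈ slitAt y) :
    ∃ δ > 0, ∀ a : ℝ, y ≤ a → δ ≤ ‖(a : ℂ) + z‖ := by
  obtain ⟨δ, hδ, hball⟩ := Metric.isOpen_iff.1 (isOpen_slitAt y) z hz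
  refine ⟨δ, hδ, fun a ha ↦ ?_⟩
  by_contra! hlt
  refine hball (a := ((-a : ℝ) : ℂ)) ?_ ⟨-a, neg_le_neg ha, rfl⟩
  rwa [mem_ball_iff_norm', Complex.ofReal_neg, sub_neg_eq_add, add_comm]

theorem eqOn_slitAt_of_eqOn_real {E : Type*} [NormedAddCommGroup E] [NormedSpace ℂ E]
    [CompleteSpace E] {f g : ℂ → E} (hf : DifferentiableOn ℂ f (slitAt y))
    (hg : DifferentiableOn ℂ g (slitAt y)) (h : ∀ t : ℝ, -y < t → f t = g t) :
    EqOn f g (slitAt y) := by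
  have hmem : -y < 1 - y := by linarith
  refine (hf.analyticOnNhd (isOpen_slitAt y)).eqOn_of_preconnected_of_frequently_eq
    (hg.analyticOnNhd (isOpen_slitAt y)) (isPreconnected_slitAt y) (ofReal_mem_slitAt hmem) ?_
  have hreal : ∀ᶠ t : ℝ in 𝓝[≠] (1 - y), f t = g t :=
    nhdsWithin_le_nhds <| mem_of_superset (Ioi_mem_nhds hmem) h
  exact (Complex.continuous_ofReal.continuousAt.continuousWithinAt.tendsto_nhdsWithin
    fun t ht ↦ Complex.ofReal_injective.ne ht).frequently hreal.frequently

theorem differentiableOn_stieltjesTransform {μ : Measure ℝ} [IsFiniteMeasure μ]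
    (hμ : ∀ᵐ a ∂μ, y ≤ a) (n : ℕ) :
    DifferentiableOn ℂ (stieltjesTransform μ n) (slitAt y) := fun z hz ↦ by
  obtain ⟨δ, hδ, hbound⟩ := exists_le_norm_add_of_mem_slitAt hz
  exact (hasDerivAt_stieltjesTransform n hδ
    (hμ.mono hbound)).differentiableAt.differentiableWithinAt

theorem exists_re_pos_and_mul_re_pos {w : ℂ} (hw : w ∈ Complex.slitPlane) :
    ∃ ω : ℂ, 0 < ω.re ∧ 0 < (ω * w).re := by
  have hnorm : 0 < ‖w‖ := norm_pos_iff.2 (Complex.slitPlane_ne_zero hw)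
  have hsum : 0 < ‖w‖ + w.re := by
    rcases hw with hre | him
    · positivity
    · linarith [neg_abs_le w.re, Complex.abs_re_lt_norm.2 him]
  -- `conj w + ‖w‖` bisects the angle between `conj w` and the positive real axis.
  refine ⟨(starRingEnd ℂ) w + ‖w‖, by simpa [add_comm] using hsum, ?_⟩
  have hre : (((starRingEnd ℂ) w + ‖w‖) * w).re = ‖w‖ * (‖w‖ + w.re) := by
    rw [add_mul, Complex.conj_mul', Complex.add_re, Complex.re_ofReal_mul, ← Complex.ofReal_pow,
      Complex.ofReal_re]
    ring
  exact hre ▸ mul_pos hnorm hsum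

end SlitPlane

section RayLaplace

variable {μ : Measure ℝ} {y : ℝ} {ω z : ℂ}

theorem integrableOn_exp_neg_mul {c : ℂ} (hc : 0 < c.re) :
    IntegrableOn (fun r : ℝ ↦ Complex.exp (-(c * r))) (Ioi 0) := by
  simpa [neg_mul] using integrableOn_exp_mul_complex_Ioi (a := -c) (by simpa) 0

theorem integral_exp_neg_mul {c : ℂ} (hc : 0 < c.re) :
    ∫ r in Ioi (0 : ℝ), Complex.exp (-(c * r)) = c⁻¹ := by
  simpa [neg_mul, neg_div] using integral_exp_mul_complex_Ioi (a := -c) (by simpa) 0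

theorem integral_norm_exp_neg_mul {c : ℂ} (hc : 0 < c.re) :
    ∫ r in Ioi (0 : ℝ), ‖Complex.exp (-(c * r))‖ = c.re⁻¹ := by
  simpa [Complex.norm_exp, neg_mul, neg_div] using integral_exp_mul_Ioi (a := -c.re) (by simpa) 0

theorem mul_sub_le_re_mul_add (hz : 0 ≤ (ω * (y + z)).re) (a : ℝ) :
    ω.re * (a - y) ≤ (ω * (a + z)).re := by
  have hsplit : ω * ((a : ℂ) + z) = ω * ((a - y : ℝ) : ℂ) + ω * (y + z) := by
    push_cast
    ring
  rw [hsplit, Complex.add_re, Complex.re_mul_ofReal]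
  exact le_add_of_nonneg_right hz

theorem integrable_ray_exp [SFinite μ] (hμ : ∀ᵐ a ∂μ, y < a)
    (hint : Integrable (fun a ↦ (a - y)⁻¹) μ) (hω : 0 < ω.re) (hz : 0 ≤ (ω * (y + z)).re) :
    Integrable (fun p : ℝ × ℝ ↦ Complex.exp (-(ω * (p.2 + z) * p.1)))
      ((volume.restrict (Ioi 0)).prod μ) := by
  have hre : ∀ᵐ a : ℝ ∂μ, 0 < ω.re * (a - y) ∧ ω.re * (a - y) ≤ (ω * (a + z)).re :=
    hμ.mono fun a ha ↦ ⟨mul_pos hω (sub_pos.2 ha), mul_sub_le_re_mul_add hz a⟩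
  have hcont : Continuous fun p : ℝ × ℝ ↦ Complex.exp (-(ω * (p.2 + z) * p.1)) := by fun_prop
  refine (integrable_prod_iff' hcont.aestronglyMeasurable).2
    ⟨hre.mono fun a ha ↦ integrableOn_exp_neg_mul (ha.1.trans_le ha.2), ?_⟩
  refine (hint.const_mul ω.re⁻¹).mono' (hcont.norm.aestronglyMeasurable
    (μ := (volume.restrict (Ioi 0)).prod μ)).prod_swap.integral_prod_right' ?_
  filter_upwards [hre] with a ha
  have hpos := ha.1.trans_le ha.2
  rw [integral_norm_exp_neg_mul hpos, Real.norm_of_nonneg (inv_nonneg.2 hpos.le), ← mul_inv]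
  exact inv_anti₀ ha.1 ha.2

theorem alongRay_laplace (ω z : ℂ) (r : ℝ) :
    alongRay (fun s ↦ ∫ a, Complex.exp (-(s * (a + z))) ∂μ) ω r =
      (∫ a : ℝ, Complex.exp (-(ω * (a + z) * r)) ∂μ) * ω := by
  simp only [alongRay, mul_right_comm]

theorem integrableOn_alongRay_laplace [SFinite μ] (hμ : ∀ᵐ a ∂μ, y < a)
    (hint : Integrable (fun a ↦ (a - y)⁻¹) μ) (hω : 0 < ω.re) (hz : 0 ≤ (ω * (y + z)).re) :
    IntegrableOn (alongRay (fun s ↦ ∫ a, Complex.exp (-(s * (a + z))) ∂μ) ω) (Ioi 0) := by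
  rw [funext (alongRay_laplace ω z)]
  exact (integrable_ray_exp hμ hint hω hz).integral_prod_left.mul_const ω

theorem integral_alongRay_laplace [SFinite μ] (hμ : ∀ᵐ a ∂μ, y < a)
    (hint : Integrable (fun a ↦ (a - y)⁻¹) μ) (hω : 0 < ω.re) (hz : 0 ≤ (ω * (y + z)).re) :
    ∫ r in Ioi (0 : ℝ), alongRay (fun s ↦ ∫ a, Complex.exp (-(s * (a + z))) ∂μ) ω r =
      stieltjesTransform μ 1 z := by
  have hω0 : ω ≠ 0 := fun h ↦ hω.ne' (by rw [h, Complex.zero_re])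
  simp_rw [alongRay_laplace]
  rw [integral_mul_const, integral_integral_swap (integrable_ray_exp hμ hint hω hz),
    ← integral_mul_const, stieltjesTransform]
  refine integral_congr_ae (hμ.mono fun a ha ↦ ?_)
  have hpos : 0 < (ω * ((a : ℂ) + z)).re :=
    (mul_pos hω (sub_pos.2 ha)).trans_le (mul_sub_le_re_mul_add hz a)
  change (∫ r in Ioi (0 : ℝ), Complex.exp (-(ω * (a + z) * r))) * ω = (((a : ℂ) + z) ^ 1)⁻¹
  rw [integral_exp_neg_mul hpos, mul_inv_rev, inv_mul_cancel_right₀ hω0, pow_one]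

end RayLaplace

section BetaIntegral

variable {x y α β : ℝ}

theorem integral_rpow_mul_one_sub_rpow (hα : 0 < α) (hβ : 0 < β) :
    ∫ u in Ioo (0 : ℝ) 1, u ^ (α - 1) * (1 - u) ^ (β - 1) = ProbabilityTheory.beta α β := by
  have hreal : ∀ u ∈ Ioo (0 : ℝ) 1, (u : ℂ) ^ ((α : ℂ) - 1) * (1 - (u : ℂ)) ^ ((β : ℂ) - 1) =
      ((u ^ (α - 1) * (1 - u) ^ (β - 1) : ℝ) : ℂ) := by
    intro u hu
    rw [Complex.ofReal_mul, Complex.ofReal_cpow hu.1.le, Complex.ofReal_cpow (sub_pos.2 hu.2).le]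
    push_cast
    rfl
  rw [ProbabilityTheory.beta_eq_betaIntegralReal α β hα hβ, Complex.betaIntegral,
    intervalIntegral.integral_of_le zero_le_one, integral_Ioc_eq_integral_Ioo,
    setIntegral_congr_fun measurableSet_Ioo hreal, integral_complex_ofReal, Complex.ofReal_re]

theorem hasDerivAt_mul_sub_div {p q a : ℝ} (ha : p * (a - y) + q * (x - a) ≠ 0) :
    HasDerivAt (fun a ↦ p * (a - y) / (p * (a - y) + q * (x - a)))
      (p * q * (x - y) / (p * (a - y) + q * (x - a)) ^ 2) a := by
  have hnum := ((hasDerivAt_id a).sub_const y).const_mul p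
  have hden := hnum.add (((hasDerivAt_id a).const_sub x).const_mul q)
  refine (hnum.div hden ha).congr_deriv ?_
  simp only [id, Pi.add_apply]
  congr 1
  ring

-- Substitute `u = p (a - y) / (p (a - y) + q (x - a))` in the Beta integral.
theorem integral_rpow_mul_rpow_mul_rpow_neg (hα : 0 < α) (hβ : 0 < β) (hyx : y < x) {p q : ℝ}
    (hp : 0 < p) (hq : 0 < q) :
    ∫ a in Ioo y x, (a - y) ^ (α - 1) * (x - a) ^ (β - 1) *
      (p * (a - y) + q * (x - a)) ^ (-(α + β)) =
      ProbabilityTheory.beta α β / (p ^ α * q ^ β * (x - y)) := by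
  have hd : 0 < x - y := sub_pos.2 hyx
  have hD : ∀ a ∈ Icc y x, 0 < p * (a - y) + q * (x - a) := fun a ha ↦ by
    rcases ha.1.eq_or_lt with rfl | hya
    · rw [sub_self, mul_zero, zero_add]
      exact mul_pos hq hd
    · exact add_pos_of_pos_of_nonneg (mul_pos hp (sub_pos.2 hya))
        (mul_nonneg hq.le (sub_nonneg.2 ha.2))
  have hderiv (a : ℝ) (ha : a ∈ Icc y x) := hasDerivAt_mul_sub_div (hD a ha).ne'
  have hsubst := integral_Icc_deriv_smul_of_deriv_nonneg
    (g := fun u ↦ u ^ (α - 1) * (1 - u) ^ (β - 1))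
    (fun a ha ↦ (hderiv a ha).continuousAt.continuousWithinAt)
    (fun a ha ↦ hderiv a (Ioo_subset_Icc_self ha))
    (fun _ _ ↦ div_nonneg (mul_pos (mul_pos hp hq) hd).le (sq_nonneg _)) hyx.le
  simp only [sub_self, mul_zero, zero_div, add_zero, div_self (mul_pos hp hd).ne',
    integral_Icc_eq_integral_Ioo, integral_rpow_mul_one_sub_rpow hα hβ, smul_eq_mul] at hsubst
  rw [← hsubst, eq_div_iff (by positivity), ← integral_mul_const]
  refine setIntegral_congr_fun measurableSet_Ioo fun a ha ↦ ?_
  have hpos := hD a (Ioo_subset_Icc_self ha)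
  have hay : 0 < a - y := sub_pos.2 ha.1
  have hxa : 0 < x - a := sub_pos.2 ha.2
  have hcompl : 1 - p * (a - y) / (p * (a - y) + q * (x - a)) =
      q * (x - a) / (p * (a - y) + q * (x - a)) := by
    field_simp
    ring
  simp only [hcompl]
  rw [Real.div_rpow (by positivity) hpos.le, Real.div_rpow (by positivity) hpos.le,
    Real.mul_rpow hp.le hay.le, Real.mul_rpow hq.le hxa.le, Real.rpow_neg hpos.le,
    Real.rpow_add hpos]
  simp only [Real.rpow_sub_one, hp.ne', hq.ne', hay.ne', hxa.ne', hpos.ne', ne_eq,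
    not_false_eq_true]
  field_simp

theorem integral_rpow_mul_rpow (hα : 0 < α) (hβ : 0 < β) (hyx : y < x) :
    ∫ a in Ioo y x, (a - y) ^ (α - 1) * (x - a) ^ (β - 1) =
      (x - y) ^ (α + β - 1) * ProbabilityTheory.beta α β := by
  have hd : 0 < x - y := sub_pos.2 hyx
  have h := integral_rpow_mul_rpow_mul_rpow_neg hα hβ hyx one_pos one_pos
  simp only [one_mul, sub_add_sub_cancel', Real.one_rpow, integral_mul_const] at h
  rw [Real.rpow_neg hd.le, ← div_eq_mul_inv, div_eq_iff (by positivity)] at h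
  rw [h, Real.rpow_sub_one hd.ne']
  ring

theorem integrableOn_rpow_mul_rpow (hα : 0 < α) (hβ : 0 < β) (hyx : y < x) :
    IntegrableOn (fun a ↦ (a - y) ^ (α - 1) * (x - a) ^ (β - 1)) (Ioo y x) := by
  refine .of_integral_ne_zero ?_
  rw [integral_rpow_mul_rpow hα hβ hyx]
  exact (mul_pos (Real.rpow_pos_of_pos (sub_pos.2 hyx) _)
    (ProbabilityTheory.beta_pos hα hβ)).ne'

theorem integral_rpow_mul_rpow_mul_add_rpow_neg (hα : 0 < α) (hβ : 0 < β) (hyx : y < x) {t : ℝ}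
    (ht : -y < t) :
    ∫ a in Ioo y x, (a - y) ^ (α - 1) * (x - a) ^ (β - 1) * (a + t) ^ (-(α + β)) =
      (x - y) ^ (α + β - 1) * ProbabilityTheory.beta α β / ((x + t) ^ α * (y + t) ^ β) := by
  have hd : 0 < x - y := sub_pos.2 hyx
  have hyt : 0 < y + t := neg_lt_iff_pos_add'.1 ht
  have hxt : 0 < x + t := by linarith
  have hpole : ∀ a ∈ Ioo y x, ((x + t) * (a - y) + (y + t) * (x - a)) ^ (-(α + β)) =
      (x - y) ^ (-(α + β)) * (a + t) ^ (-(α + β)) := fun a ha ↦ by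
    rw [← Real.mul_rpow hd.le (by linarith [ha.1])]
    congr 1
    ring
  have h := integral_rpow_mul_rpow_mul_rpow_neg hα hβ hyx hxt hyt
  rw [setIntegral_congr_fun measurableSet_Ioo fun a ha ↦ by rw [hpole a ha, mul_left_comm],
    integral_const_mul, Real.rpow_neg hd.le, inv_mul_eq_iff_eq_mul₀ (by positivity)] at h
  rw [h, Real.rpow_sub_one hd.ne']
  field_simp

end BetaIntegral

/-- The modulus of the boundary values at `-a`, `y < a < x`, of `weightedGeomC x y l` on its cut.
By Stieltjes inversion, `sin(lπ)/π` times this density represents the weighted mean. -/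
noncomputable def meanDensity (x y l a : ℝ) : ℝ :=
  (a - y) ^ (1 - l) * (x - a) ^ l

/-- The measure on `(y,x)` with density `meanDensity x y l`, in terms of which the weighted mean is
a Stieltjes transform and the kernel `F` a Laplace transform. -/
noncomputable def meanMeasure (x y l : ℝ) : Measure ℝ :=
  (volume.restrict (Ioo y x)).withDensity fun a ↦ ENNReal.ofReal (meanDensity x y l a)

section MeanMeasure

variable {E : Type*} [NormedAddCommGroup E] [NormedSpace ℝ E] {x y l : ℝ}

theorem meanDensity_nonneg {a : ℝ} (ha : a ∈ Icc y x) : 0 ≤ meanDensity x y l a :=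
  mul_nonneg (Real.rpow_nonneg (sub_nonneg.2 ha.1) _) (Real.rpow_nonneg (sub_nonneg.2 ha.2) _)

theorem continuous_meanDensity (hl0 : 0 ≤ l) (hl1 : l ≤ 1) : Continuous (meanDensity x y l) :=
  ((continuous_id.sub continuous_const).rpow_const fun _ ↦ .inr (sub_nonneg.2 hl1)).mul
    ((continuous_const.sub continuous_id).rpow_const fun _ ↦ .inr hl0)

theorem measurable_meanDensity : Measurable (meanDensity x y l) := by
  unfold meanDensity
  fun_prop

theorem ae_mem_Ioo_meanMeasure (x y l : ℝ) : ∀ᵐ a ∂meanMeasure x y l, a ∈ Ioo y x :=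
  (withDensity_absolutelyContinuous _ _).ae_le (ae_restrict_mem measurableSet_Ioo)

theorem integral_meanMeasure (x y l : ℝ) (f : ℝ → E) :
    ∫ a, f a ∂meanMeasure x y l = ∫ a in Ioo y x, meanDensity x y l a • f a := by
  rw [meanMeasure, integral_withDensity_eq_integral_toReal_smul
    measurable_meanDensity.ennreal_ofReal (.of_forall fun _ ↦ ENNReal.ofReal_lt_top)]
  refine setIntegral_congr_fun measurableSet_Ioo fun a ha ↦ ?_
  simp only [ENNReal.toReal_ofReal (meanDensity_nonneg (Ioo_subset_Icc_self ha))]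

theorem integrable_meanMeasure_iff {f : ℝ → E} :
    Integrable f (meanMeasure x y l) ↔
      IntegrableOn (fun a ↦ meanDensity x y l a • f a) (Ioo y x) := by
  rw [meanMeasure, integrable_withDensity_iff_integrable_smul'
    measurable_meanDensity.ennreal_ofReal (.of_forall fun _ ↦ ENNReal.ofReal_lt_top)]
  refine integrableOn_congr_fun (fun a ha ↦ ?_) measurableSet_Ioo
  simp only [ENNReal.toReal_ofReal (meanDensity_nonneg (Ioo_subset_Icc_self ha))]

instance sFinite_meanMeasure (x y l : ℝ) : SFinite (meanMeasure x y l) := by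
  unfold meanMeasure
  infer_instance

theorem isFiniteMeasure_meanMeasure (hl0 : 0 ≤ l) (hl1 : l ≤ 1) :
    IsFiniteMeasure (meanMeasure x y l) :=
  isFiniteMeasure_withDensity_ofReal <|
    ((continuous_meanDensity hl0 hl1).integrableOn_Icc.mono_set Ioo_subset_Icc_self).2

theorem integrable_inv_sub_meanMeasure (hl0 : -1 < l) (hl1 : l < 1) (hyx : y < x) :
    Integrable (fun a ↦ (a - y)⁻¹) (meanMeasure x y l) := by
  refine integrable_meanMeasure_iff.2 <| (integrableOn_rpow_mul_rpow (α := 1 - l) (β := l + 1)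
    (by linarith) (by linarith) hyx).congr_fun (fun a ha ↦ ?_) measurableSet_Ioo
  simp only [meanDensity, smul_eq_mul, Real.rpow_sub_one (sub_pos.2 ha.1).ne', add_sub_cancel_right]
  ring

theorem beta_one_sub_self (l : ℝ) :
    ProbabilityTheory.beta (1 - l) l = Real.pi / Real.sin (l * Real.pi) := by
  rw [ProbabilityTheory.beta, sub_add_cancel, Real.Gamma_one, div_one, mul_comm,
    Real.Gamma_mul_Gamma_one_sub, mul_comm l]

theorem beta_one_sub_add_one (hl : l ≠ 0) :
    ProbabilityTheory.beta (1 - l) (l + 1) = l * ProbabilityTheory.beta (1 - l) l := by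
  rw [ProbabilityTheory.beta, ProbabilityTheory.beta, Real.Gamma_add_one hl, ← add_assoc,
    sub_add_cancel, Real.Gamma_add_one one_ne_zero]
  ring

theorem meanDensity_mul_inv_add {a t : ℝ} (ha : a ∈ Ioo y x) (ht : -y < t) :
    meanDensity x y l a * (a + t)⁻¹ =
      (a - y) ^ (1 - l - 1) * (x - a) ^ (l + 1 - 1) +
      (y + t) * ((a - y) ^ (1 - l - 1) * (x - a) ^ (l - 1)) -
      (x + t) * (y + t) *
        ((a - y) ^ (1 - l - 1) * (x - a) ^ (l - 1) * (a + t) ^ (-(1 - l + l))) := by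
  have hay : 0 < a - y := sub_pos.2 ha.1
  have hxa : 0 < x - a := sub_pos.2 ha.2
  have hat : 0 < a + t := by linarith [ha.1]
  rw [meanDensity, sub_add_cancel, Real.rpow_neg_one, add_sub_cancel_right,
    Real.rpow_sub_one hay.ne', Real.rpow_sub_one hxa.ne']
  field_simp
  ring

theorem stieltjesTransform_meanMeasure (hl0 : 0 < l) (hl1 : l < 1) (hyx : y < x) {t : ℝ}
    (ht : -y < t) :
    stieltjesTransform (meanMeasure x y l) 1 t =
      ProbabilityTheory.beta (1 - l) l * (l * x + (1 - l) * y + t - weightedGeom x y l t) := by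
  have hyt : 0 < y + t := neg_lt_iff_pos_add'.1 ht
  have hxt : 0 < x + t := by linarith
  have hl1' : 0 < 1 - l := sub_pos.2 hl1
  have hweight := integrableOn_rpow_mul_rpow hl1' hl0 hyx
  have hmoment := integrableOn_rpow_mul_rpow hl1' (add_pos hl0 one_pos) hyx
  have hpole : IntegrableOn (fun a ↦ (a - y) ^ (1 - l - 1) * (x - a) ^ (l - 1) *
      (a + t) ^ (-(1 - l + l))) (Ioo y x) := by
    refine .of_integral_ne_zero ?_
    rw [integral_rpow_mul_rpow_mul_add_rpow_neg hl1' hl0 hyx ht]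
    have := ProbabilityTheory.beta_pos hl1' hl0
    have := sub_pos.2 hyx
    positivity
  have hsum : IntegrableOn (fun a ↦ (a - y) ^ (1 - l - 1) * (x - a) ^ (l + 1 - 1) +
      (y + t) * ((a - y) ^ (1 - l - 1) * (x - a) ^ (l - 1))) (Ioo y x) :=
    hmoment.add (hweight.const_mul _)
  rw [stieltjesTransform, integral_meanMeasure]
  simp only [RCLike.ofReal_real_eq_id, id, pow_one, smul_eq_mul]
  rw [setIntegral_congr_fun measurableSet_Ioo fun a ha ↦ meanDensity_mul_inv_add ha ht,
    integral_sub hsum (hpole.const_mul _),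
    integral_add hmoment (hweight.const_mul _), integral_const_mul, integral_const_mul,
    integral_rpow_mul_rpow hl1' (add_pos hl0 one_pos) hyx, integral_rpow_mul_rpow hl1' hl0 hyx,
    integral_rpow_mul_rpow_mul_add_rpow_neg hl1' hl0 hyx ht, beta_one_sub_add_one hl0.ne',
    weightedGeom, Real.rpow_sub hxt, Real.rpow_sub hyt, Real.rpow_one, Real.rpow_one,
    show 1 - l + (l + 1) - 1 = 1 by ring, show 1 - l + l - 1 = 0 by ring, Real.rpow_one,
    Real.rpow_zero]
  field_simp
  ring

end MeanMeasure

section Representation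

variable {x y l : ℝ}

theorem weightedGeom_eq_sub_stieltjesTransform (hl0 : 0 < l) (hl1 : l < 1) (hyx : y ≤ x) {t : ℝ}
    (ht : -y < t) :
    weightedGeom x y l t = l * x + (1 - l) * y + t -
      Real.sin (l * Real.pi) / Real.pi * stieltjesTransform (meanMeasure x y l) 1 t := by
  rcases hyx.eq_or_lt with rfl | hlt
  · rw [weightedGeom, ← Real.rpow_add (neg_lt_iff_pos_add'.1 ht), stieltjesTransform,
      integral_meanMeasure, Ioo_self, setIntegral_empty, add_sub_cancel, Real.rpow_one]
    ring
  · have hsin : 0 < Real.sin (l * Real.pi) := Real.sin_pos_of_pos_of_lt_pi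
      (mul_pos hl0 Real.pi_pos) (mul_lt_of_lt_one_left Real.pi_pos hl1)
    rw [stieltjesTransform_meanMeasure hl0 hl1 hlt ht, beta_one_sub_self]
    field_simp [Real.pi_ne_zero]
    ring

theorem weightedGeomC_ofReal (hyx : y ≤ x) {t : ℝ} (ht : -y < t) :
    weightedGeomC x y l t = (weightedGeom x y l t : ℂ) := by
  have hyt : 0 < y + t := neg_lt_iff_pos_add'.1 ht
  have hxt : 0 < x + t := by linarith
  rw [weightedGeomC, weightedGeom, Complex.ofReal_mul, Complex.ofReal_cpow hxt.le,
    Complex.ofReal_cpow hyt.le, Complex.ofReal_add, Complex.ofReal_add]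

theorem differentiableOn_weightedGeomC (hyx : y ≤ x) :
    DifferentiableOn ℂ (weightedGeomC x y l) (slitAt y) := fun _ hz ↦
  (((differentiableAt_id.const_add _).cpow_const (mem_slitAt_iff.1 (monotone_slitAt hyx hz))).mul
    ((differentiableAt_id.const_add _).cpow_const (mem_slitAt_iff.1 hz))).differentiableWithinAt

theorem weightedGeomC_eq_sub_stieltjesTransform (hl0 : 0 < l) (hl1 : l < 1) (hyx : y ≤ x) {z : ℂ}
    (hz : z ∈ slitAt y) :
    weightedGeomC x y l z = ((l * x + (1 - l) * y : ℝ) : ℂ) + z -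
      ((Real.sin (l * Real.pi) / Real.pi : ℝ) : ℂ) *
        stieltjesTransform (meanMeasure x y l) 1 z := by
  have := isFiniteMeasure_meanMeasure (x := x) (y := y) hl0.le hl1.le
  have hS : DifferentiableOn ℂ (stieltjesTransform (meanMeasure x y l) 1) (slitAt y) :=
    differentiableOn_stieltjesTransform
      ((ae_mem_Ioo_meanMeasure x y l).mono fun _ ha ↦ ha.1.le) 1
  refine eqOn_slitAt_of_eqOn_real (differentiableOn_weightedGeomC hyx)
    ((differentiableOn_id.const_add _).sub (hS.const_mul _)) (fun t ht ↦ ?_) hz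
  simp only [Pi.sub_apply]
  rw [weightedGeomC_ofReal hyx ht, weightedGeom_eq_sub_stieltjesTransform hl0 hl1 hyx ht,
    stieltjesTransform_ofReal]
  push_cast
  rfl

end Representation

section Kernel

variable {l u : ℝ}

theorem kernelWeight_eq (hu : u ∈ Ioo (0 : ℝ) 1) :
    kernelWeight l u = (1 - l - u) * (u ^ (-l) * (1 - u) ^ (l - 1)) := by
  have hu1 : 0 < 1 - u := sub_pos.2 hu.2
  rw [kernelWeight, one_div, inv_eq_one_div, div_sub_one hu.1.ne', Real.div_rpow hu1.le hu.1.le,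
    Real.rpow_neg hu.1.le, Real.rpow_sub_one hu1.ne']
  field_simp
  ring

theorem hasDerivAt_meanDensity (hu : u ∈ Ioo (0 : ℝ) 1) :
    HasDerivAt (meanDensity 1 0 l) (kernelWeight l u) u := by
  have hu1 : 0 < 1 - u := sub_pos.2 hu.2
  have hleft := ((hasDerivAt_id u).sub_const 0).rpow_const (p := 1 - l)
    (.inl (by simpa using hu.1.ne'))
  have hright := ((hasDerivAt_id u).const_sub 1).rpow_const (p := l) (.inl hu1.ne')
  have hpow : u ^ (1 - l) = u ^ (-l) * u := by rw [sub_eq_neg_add, Real.rpow_add_one hu.1.ne']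
  refine (hleft.mul hright).congr_deriv ?_
  simp only [kernelWeight_eq hu, id, sub_zero, Real.rpow_sub_one hu1.ne',
    show 1 - l - 1 = -l by ring, hpow]
  field_simp
  ring

theorem integrableOn_kernelWeight (hl0 : 0 < l) (hl1 : l < 1) :
    IntegrableOn (kernelWeight l) (Icc 0 1) := by
  have hweight := integrableOn_rpow_mul_rpow (sub_pos.2 hl1) hl0 one_pos
  rw [← integrableOn_Icc_iff_integrableOn_Ioo] at hweight
  rw [integrableOn_Icc_iff_integrableOn_Ioo]
  refine ((hweight.continuousOn_mul (continuous_sub_left (1 - l)).continuousOn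
    isCompact_Icc).mono_set Ioo_subset_Icc_self).congr_fun (fun u hu ↦ ?_) measurableSet_Ioo
  simp only [kernelWeight_eq hu, sub_zero, show 1 - l - 1 = -l by ring]

theorem integrableOn_kernelWeight_mul_cexp (hl0 : 0 < l) (hl1 : l < 1) (s : ℂ) :
    IntegrableOn (fun u : ℝ ↦ (kernelWeight l u : ℂ) * Complex.exp (-(u * s))) (Ioo 0 1) := by
  have hexp : Continuous fun u : ℝ ↦ Complex.exp (-(u * s)) := by fun_prop
  have hweight : IntegrableOn (fun u ↦ (kernelWeight l u : ℂ)) (Icc 0 1) :=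
    (integrableOn_kernelWeight hl0 hl1).ofReal
  exact (hweight.mul_continuousOn hexp.continuousOn isCompact_Icc).mono_set Ioo_subset_Icc_self

theorem integrableOn_kernelWeight_mul_exp (hl0 : 0 < l) (hl1 : l < 1) (s : ℝ) :
    IntegrableOn (fun u ↦ kernelWeight l u * Real.exp (-(u * s))) (Ioo 0 1) := by
  have hexp : Continuous fun u ↦ Real.exp (-(u * s)) := by fun_prop
  exact ((integrableOn_kernelWeight hl0 hl1).mul_continuousOn hexp.continuousOn
    isCompact_Icc).mono_set Ioo_subset_Icc_self

theorem kernelFC_ofReal (l s : ℝ) : kernelFC l s = (kernelF l s : ℂ) := by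
  rw [kernelFC, kernelF, ← integral_complex_ofReal]
  push_cast
  rfl

-- Integrate by parts: `kernelWeight l` is the derivative of `meanDensity 1 0 l`, which vanishes at
-- both endpoints.
theorem kernelFC_eq_mul_laplace (hl0 : 0 < l) (hl1 : l < 1) (s : ℂ) :
    kernelFC l s = s * ∫ u, Complex.exp (-(s * u)) ∂meanMeasure 1 0 l := by
  have hcont : Continuous fun u : ℝ ↦ (meanDensity 1 0 l u : ℂ) * Complex.exp (-(u * s)) := by
    have := continuous_meanDensity (x := 1) (y := 0) hl0.le hl1.le
    fun_prop
  have hweight := integrableOn_kernelWeight_mul_cexp hl0 hl1 s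
  have hdensity : IntegrableOn (fun u : ℝ ↦ s * ((meanDensity 1 0 l u : ℂ) *
      Complex.exp (-(u * s)))) (Ioo 0 1) :=
    (hcont.integrableOn_Icc.mono_set Ioo_subset_Icc_self).const_mul s
  have hderiv (u : ℝ) (hu : u ∈ Ioo (0 : ℝ) 1) :
      HasDerivAt (fun u : ℝ ↦ (meanDensity 1 0 l u : ℂ) * Complex.exp (-(u * s)))
        ((kernelWeight l u : ℂ) * Complex.exp (-(u * s)) -
          s * ((meanDensity 1 0 l u : ℂ) * Complex.exp (-(u * s)))) u := by
    refine ((hasDerivAt_meanDensity hu).ofReal_comp.mul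
      (((hasDerivAt_id u).ofReal_comp.mul_const s).neg.cexp)).congr_deriv ?_
    simp only [id, Complex.ofReal_one, Pi.neg_apply]
    ring
  have hparts := intervalIntegral.integral_eq_sub_of_hasDerivAt_of_le zero_le_one
    hcont.continuousOn hderiv
    ((intervalIntegrable_iff_integrableOn_Ioo_of_le zero_le_one).2 (hweight.sub hdensity))
  have hzero : meanDensity 1 0 l 0 = 0 := by
    rw [meanDensity, sub_zero, Real.zero_rpow (sub_pos.2 hl1).ne', zero_mul]
  have hone : meanDensity 1 0 l 1 = 0 := by
    rw [meanDensity, sub_self, Real.zero_rpow hl0.ne', mul_zero]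
  rw [intervalIntegral.integral_of_le zero_le_one, integral_Ioc_eq_integral_Ioo,
    integral_sub hweight hdensity, integral_const_mul, hzero, hone, Complex.ofReal_zero, zero_mul,
    zero_mul, sub_zero, sub_eq_zero] at hparts
  rw [kernelFC, hparts, integral_meanMeasure]
  simp only [Complex.real_smul, mul_comm s]

theorem kernelF_eq_mul_laplace (hl0 : 0 < l) (hl1 : l < 1) (s : ℝ) :
    kernelF l s = s * ∫ u, Real.exp (-(s * u)) ∂meanMeasure 1 0 l := by
  have h := kernelFC_eq_mul_laplace hl0 hl1 s
  rw [kernelFC_ofReal] at h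
  rw [← Complex.ofReal_inj, h, Complex.ofReal_mul, ← integral_complex_ofReal]
  push_cast
  rfl

theorem kernelF_pos (hl0 : 0 < l) (hl1 : l < 1) {s : ℝ} (hs : 0 < s) : 0 < kernelF l s := by
  rw [kernelF_eq_mul_laplace hl0 hl1, integral_meanMeasure, ← integral_Ioc_eq_integral_Ioo,
    ← intervalIntegral.integral_of_le zero_le_one]
  have hcont : Continuous fun u ↦ meanDensity 1 0 l u • Real.exp (-(s * u)) :=
    (continuous_meanDensity hl0.le hl1.le).smul (by fun_prop)
  have hpos (u : ℝ) (hu : u ∈ Ioo (0 : ℝ) 1) : 0 < meanDensity 1 0 l u :=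
    mul_pos (Real.rpow_pos_of_pos (sub_pos.2 hu.1) _) (Real.rpow_pos_of_pos (sub_pos.2 hu.2) _)
  exact mul_pos hs <| intervalIntegral.intervalIntegral_pos_of_pos_on
    (hcont.intervalIntegrable 0 1) (fun u hu ↦ smul_pos (hpos u hu) (Real.exp_pos _)) one_pos

end Kernel

section RayRepresentation

variable {x y l : ℝ} {z ω : ℂ}

theorem meanDensity_comp_add_mul (hyx : y ≤ x) {u : ℝ} (hu : u ∈ Icc (0 : ℝ) 1) :
    meanDensity x y l (y + (x - y) * u) = (x - y) * meanDensity 1 0 l u := by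
  have hd := sub_nonneg.2 hyx
  rw [meanDensity, meanDensity, add_sub_cancel_left, sub_zero,
    show x - (y + (x - y) * u) = (x - y) * (1 - u) by ring, Real.mul_rpow hd hu.1,
    Real.mul_rpow hd (sub_nonneg.2 hu.2), mul_mul_mul_comm, ← Real.rpow_add' hd (by simp),
    sub_add_cancel, Real.rpow_one]

theorem integral_meanMeasure_eq_integral_unit {E : Type*} [NormedAddCommGroup E] [NormedSpace ℝ E]
    (hyx : y ≤ x) (f : ℝ → E) :
    ∫ a, f a ∂meanMeasure x y l =
      (x - y) ^ 2 • ∫ u, f (y + (x - y) * u) ∂meanMeasure 1 0 l := by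
  have hsubst := intervalIntegral.smul_integral_comp_add_mul (a := 0) (b := 1)
    (fun a ↦ meanDensity x y l a • f a) (x - y) y
  rw [mul_zero, mul_one, add_zero, add_sub_cancel, intervalIntegral.integral_of_le hyx,
    intervalIntegral.integral_of_le zero_le_one, integral_Ioc_eq_integral_Ioo,
    integral_Ioc_eq_integral_Ioo] at hsubst
  rw [integral_meanMeasure, integral_meanMeasure, ← hsubst, sq, mul_smul,
    ← integral_smul (x - y) fun u ↦ meanDensity 1 0 l u • f (y + (x - y) * u)]
  congr 1
  refine setIntegral_congr_fun measurableSet_Ioo fun u hu ↦ ?_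
  simp only [meanDensity_comp_add_mul hyx (Ioo_subset_Icc_self hu), mul_smul]

theorem laplace_meanMeasure (hl0 : 0 < l) (hl1 : l < 1) (hyx : y ≤ x) (z : ℂ) {s : ℂ}
    (hs : s ≠ 0) :
    ∫ a, Complex.exp (-(s * (a + z))) ∂meanMeasure x y l =
      (x - y) * (kernelFC l ((x - y : ℝ) * s) / s * Complex.exp (-(s * y))) *
        Complex.exp (-(s * z)) := by
  have hexp (u : ℝ) : Complex.exp (-(s * ((y + (x - y) * u : ℝ) + z))) =
      Complex.exp (-(s * y)) * Complex.exp (-(s * z)) *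
        Complex.exp (-((x - y : ℝ) * s * u)) := by
    rw [← Complex.exp_add, ← Complex.exp_add]
    push_cast
    ring_nf
  rw [integral_meanMeasure_eq_integral_unit hyx, kernelFC_eq_mul_laplace hl0 hl1]
  simp only [hexp, integral_const_mul, Complex.real_smul]
  push_cast
  field_simp

theorem mul_alongRay_meanIntegrandC (hl0 : 0 < l) (hl1 : l < 1) (hyx : y ≤ x) (z : ℂ)
    {r : ℝ} (hω : ω ≠ 0) (hr : r ≠ 0) :
    (x - y) * alongRay (meanIntegrandC x y l z) ω r =
      alongRay (fun s ↦ ∫ a, Complex.exp (-(s * (a + 0))) ∂meanMeasure x y l) ω r -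
      alongRay (fun s ↦ ∫ a, Complex.exp (-(s * (a + z))) ∂meanMeasure x y l) ω r := by
  have hs : ω * r ≠ 0 := mul_ne_zero hω (Complex.ofReal_ne_zero.2 hr)
  simp only [alongRay, meanIntegrandC, laplace_meanMeasure hl0 hl1 hyx _ hs, mul_zero, neg_zero,
    Complex.exp_zero]
  ring

theorem integrableOn_alongRay_meanIntegrandC (hl0 : 0 < l) (hl1 : l < 1) (hy : 0 ≤ y)
    (hyx : y < x) (hω : 0 < ω.re) (hωz : 0 ≤ (ω * (y + z)).re) :
    IntegrableOn (alongRay (meanIntegrandC x y l z) ω) (Ioi 0) := by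
  have hω0 : ω ≠ 0 := fun h ↦ hω.ne' (by rw [h, Complex.zero_re])
  have hωy : 0 ≤ (ω * (y + 0)).re := by simpa using mul_nonneg hω.le hy
  have hxy : (x - y : ℂ) ≠ 0 := sub_ne_zero.2 (Complex.ofReal_injective.ne hyx.ne')
  have hlaplace {w : ℂ} (hw : 0 ≤ (ω * (y + w)).re) :=
    integrableOn_alongRay_laplace ((ae_mem_Ioo_meanMeasure x y l).mono fun _ ha ↦ ha.1)
      (integrable_inv_sub_meanMeasure (neg_one_lt_zero.trans hl0) hl1 hyx) hω hw
  refine IntegrableOn.congr_fun (((hlaplace hωy).sub (hlaplace hωz)).const_mul (x - y : ℂ)⁻¹)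
    (fun r hr ↦ ?_) measurableSet_Ioi
  simp only [Pi.sub_apply, ← mul_alongRay_meanIntegrandC hl0 hl1 hyx.le z hω0 (ne_of_gt hr),
    inv_mul_cancel_left₀ hxy]

theorem mul_integral_alongRay_meanIntegrandC (hl0 : 0 < l) (hl1 : l < 1) (hy : 0 ≤ y)
    (hyx : y < x) (hω : 0 < ω.re) (hωz : 0 ≤ (ω * (y + z)).re) :
    (x - y) * ∫ r in Ioi (0 : ℝ), alongRay (meanIntegrandC x y l z) ω r =
      stieltjesTransform (meanMeasure x y l) 1 0 - stieltjesTransform (meanMeasure x y l) 1 z := by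
  have hω0 : ω ≠ 0 := fun h ↦ hω.ne' (by rw [h, Complex.zero_re])
  have hωy : 0 ≤ (ω * (y + 0)).re := by simpa using mul_nonneg hω.le hy
  have hμ : ∀ᵐ a ∂meanMeasure x y l, y < a :=
    (ae_mem_Ioo_meanMeasure x y l).mono fun _ ha ↦ ha.1
  have hint := integrable_inv_sub_meanMeasure (neg_one_lt_zero.trans hl0) hl1 hyx
  rw [← integral_const_mul, setIntegral_congr_fun measurableSet_Ioi fun r hr ↦
      mul_alongRay_meanIntegrandC hl0 hl1 hyx.le z hω0 (ne_of_gt hr),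
    integral_sub (integrableOn_alongRay_laplace hμ hint hω hωy)
      (integrableOn_alongRay_laplace hμ hint hω hωz),
    integral_alongRay_laplace hμ hint hω hωy, integral_alongRay_laplace hμ hint hω hωz]

theorem weightedGeomC_eq_add_integral (hl0 : 0 < l) (hl1 : l < 1) (hy : 0 < y) (hyx : y < x)
    (hz : z ∈ slitAt y) (hω : 0 < ω.re) (hωz : 0 ≤ (ω * (y + z)).re) :
    weightedGeomC x y l z = ((x ^ l * y ^ (1 - l) : ℝ) : ℂ) + z +
      ((Real.sin (l * Real.pi) / Real.pi * (x - y) : ℝ) : ℂ) *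
        ∫ r in Ioi (0 : ℝ), alongRay (meanIntegrandC x y l z) ω r := by
  have hzero : weightedGeomC x y l 0 = ((x ^ l * y ^ (1 - l) : ℝ) : ℂ) := by
    have h := weightedGeomC_ofReal (l := l) hyx.le (neg_lt_zero.2 hy)
    rwa [weightedGeom, add_zero, add_zero] at h
  have hz0 : (0 : ℂ) ∈ slitAt y := ofReal_mem_slitAt (neg_lt_zero.2 hy)
  rw [← hzero, weightedGeomC_eq_sub_stieltjesTransform hl0 hl1 hyx.le hz0,
    weightedGeomC_eq_sub_stieltjesTransform hl0 hl1 hyx.le hz, Complex.ofReal_mul,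
    Complex.ofReal_sub x y, mul_assoc,
    mul_integral_alongRay_meanIntegrandC hl0 hl1 hy.le hyx hω hωz]
  ring

theorem meanIntegrand_eq_alongRay_one (x y l : ℝ) (z : ℂ) :
    meanIntegrand x y l z = alongRay (meanIntegrandC x y l z) 1 := by
  funext r
  rw [alongRay, meanIntegrand, meanIntegrandC, one_mul, mul_one, ← Complex.ofReal_mul,
    kernelFC_ofReal]
  push_cast
  rfl

end RayRepresentation

section Bernstein

variable {x y l : ℝ}

theorem weightedGeom_swap (x y l : ℝ) : weightedGeom x y l = weightedGeom y x (1 - l) := by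
  funext t
  rw [weightedGeom, weightedGeom, sub_sub_cancel, mul_comm]

theorem weightedGeom_nonneg {t : ℝ} (hx : -x ≤ t) (hy : -y ≤ t) : 0 ≤ weightedGeom x y l t :=
  mul_nonneg (Real.rpow_nonneg (neg_le_iff_add_nonneg'.1 hx) _)
    (Real.rpow_nonneg (neg_le_iff_add_nonneg'.1 hy) _)

theorem isBernsteinOn_weightedGeom_of_le (hl0 : 0 < l) (hl1 : l < 1) (hyx : y ≤ x) :
    IsBernsteinOn (weightedGeom x y l) (Ioi (-y)) := by
  have := isFiniteMeasure_meanMeasure (x := x) (y := y) hl0.le hl1.le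
  have hsin : 0 ≤ Real.sin (l * Real.pi) := Real.sin_nonneg_of_nonneg_of_le_pi
    (mul_nonneg hl0.le Real.pi_pos.le) (mul_le_of_le_one_left Real.pi_pos.le hl1.le)
  exact isBernsteinOn_of_eqOn_sub_stieltjesTransform
    ((ae_mem_Ioo_meanMeasure x y l).mono fun _ ha ↦ ha.1.le) (div_nonneg hsin Real.pi_pos.le)
    (fun t ht ↦ weightedGeom_nonneg ((neg_le_neg hyx).trans (le_of_lt ht)) (le_of_lt ht))
    fun t ht ↦ weightedGeom_eq_sub_stieltjesTransform hl0 hl1 hyx ht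

theorem isBernsteinOn_weightedGeom (hl0 : 0 < l) (hl1 : l < 1) (x y : ℝ) :
    IsBernsteinOn (weightedGeom x y l) (Ioi (-min x y)) := by
  rcases le_total y x with hyx | hxy
  · rw [min_eq_right hyx]
    exact isBernsteinOn_weightedGeom_of_le hl0 hl1 hyx
  · rw [min_eq_left hxy, weightedGeom_swap]
    exact isBernsteinOn_weightedGeom_of_le (sub_pos.2 hl1) (sub_lt_self 1 hl0) hxy

end Bernstein

theorem mainTheorem1 (l : ℝ) (hl0 : 0 < l) (hl1 : l < 1) :
    -- `F(l,s)` is a convergent integral and is positive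
    (∀ s : ℝ, 0 < s →
      MeasureTheory.IntegrableOn (fun u : ℝ => kernelWeight l u * Real.exp (-(u * s)))
        (Set.Ioo (0 : ℝ) 1) ∧
      0 < kernelF l s) ∧
    (∀ x y : ℝ, 0 < y → y < x →
      -- the principal branch: holomorphic on the slit plane, equal to the real mean on `(-y,∞)`
      DifferentiableOn ℂ (weightedGeomC x y l) (slitAt y) ∧
      (∀ t : ℝ, -y < t → weightedGeomC x y l (t : ℂ) = (weightedGeom x y l t : ℂ)) ∧
      -- the representation, where the integral over `(0,∞)` converges
      (∀ z ∈ slitAt y, -y ≤ z.re →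
        MeasureTheory.IntegrableOn (meanIntegrand x y l z) (Set.Ioi 0) ∧
        weightedGeomC x y l z = ((x ^ l * y ^ (1 - l) : ℝ) : ℂ) + z +
          ((Real.sin (l * Real.pi) / Real.pi * (x - y) : ℝ) : ℂ) *
            ∫ s in Set.Ioi (0 : ℝ), meanIntegrand x y l z s) ∧
      -- the representation on all of the slit plane, the integral from `0` to `∞` being taken
      -- along any ray of the right half-plane on which `e^{-s(y+z)}` does not grow
      (∀ z ∈ slitAt y, ∀ ω : ℂ, 0 < ω.re → 0 ≤ (ω * ((y : ℂ) + z)).re →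
        MeasureTheory.IntegrableOn (alongRay (meanIntegrandC x y l z) ω) (Set.Ioi 0) ∧
        weightedGeomC x y l z = ((x ^ l * y ^ (1 - l) : ℝ) : ℂ) + z +
          ((Real.sin (l * Real.pi) / Real.pi * (x - y) : ℝ) : ℂ) *
            ∫ r in Set.Ioi (0 : ℝ), alongRay (meanIntegrandC x y l z) ω r) ∧
      -- and such rays exist for every point of the slit plane
      (∀ z ∈ slitAt y, ∃ ω : ℂ, 0 < ω.re ∧ 0 < (ω * ((y : ℂ) + z)).re)) ∧
    -- the Bernstein property, for all positive `x`, `y`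
    (∀ x y : ℝ, 0 < x → 0 < y →
      IsBernsteinOn (weightedGeom x y l) (Set.Ioi (-(min x y)))) := by
  refine ⟨fun s hs ↦ ⟨integrableOn_kernelWeight_mul_exp hl0 hl1 s, kernelF_pos hl0 hl1 hs⟩,
    fun x y hy hyx ↦ ?_, fun x y _ _ ↦ isBernsteinOn_weightedGeom hl0 hl1 x y⟩
  have hray (z : ℂ) (hz : z ∈ slitAt y) (ω : ℂ) (hω : 0 < ω.re) (hωz : 0 ≤ (ω * (y + z)).re) :=
    And.intro (integrableOn_alongRay_meanIntegrandC hl0 hl1 hy.le hyx hω hωz)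
      (weightedGeomC_eq_add_integral hl0 hl1 hy hyx hz hω hωz)
  refine ⟨differentiableOn_weightedGeomC hyx.le, fun t ht ↦ weightedGeomC_ofReal hyx.le ht,
    fun z hz hre ↦ ?_, hray, fun z hz ↦ exists_re_pos_and_mul_re_pos (mem_slitAt_iff.1 hz)⟩
  rw [meanIntegrand_eq_alongRay_one]
  refine hray z hz 1 one_pos ?_
  rw [one_mul, Complex.add_re, Complex.ofReal_re]
  exact neg_le_iff_add_nonneg'.1 hre
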